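/- Fix $\kappa\in\mathbb R$ and $\theta\in(0,1]$. There is a constant $C>0$, depending only on $\kappa$ and $\theta$, such that the following holds. Let $p_{\mathrm{data}}$ be a probability measure on $\mathbb R^D$ with compact support $M$, let $\rho_0$ be an absolutely continuous probability measure on $\mathbb R^D$, let $F_0,\dots,F_{\tau-1}:\mathbb R^D\to\mathbb R^D$ be $C^1$ maps, $F^0=\mathrm{id}$, $F^{t+1}=F_t\circ F^t$, and let $T$ be an $L^2$-optimal transport map (a minimizer of the Monge problem with cost $\|T(y)-y\|^2$) from the generated law $F^\tau_\sharp\rho_0$ to $p_{\mathrm{data}}$. Let $n\ge 2$, $\delta>0$, $\epsilon_0>0$. Let $X_1,\dots,X_n$ be independent with law $\rho_0$, let $y_i=F^\tau(X_i)$ be the generated samples and $x_i=T(y_i)\sim p_{\mathrm{data}}$ the matched data samples. Let $E_t(x)$, $0\le t\le\tau$, be $D\times d$ matrices with orthonormal columns attached to the path started at $x$, with $E_0$ arbitrary (possibly random), evolved by the QR recursion $dF_t(F^t(x))\,E_t(x)=E_{t+1}(x)R_t$ with $R_t$ upper triangular; the columns of $E_\tau(X_i)$ span the most sensitive $d$-dimensional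 subspace at $y_i$. Assume * (convergence) with probability at least $1-\delta/2$, $\|T(y_i)-y_i\|\le\epsilon_0$ for all $i$; * (alignment) with probability at least $1-\delta/2$, for every $i$ with $x_i\in\partial M$, the columns of $E_\tau(X_i)$ span the tangent space $T_{x_i}\partial M$ (the linear span of the limits of secant directions of the topological boundary $\partial M$ at $x_i$). Let $\Phi:\mathbb R^D\to H$ be a strongly measurable feature map into a real inner product space with $\|\Phi\|\le\kappa$ on $M$. Then there is a solution $(w,\rho)$ of the one-class support vector problem on $x_1,\dots,x_n$, $$\min_{w,\rho}\ \tfrac12\|w\|^2-\rho\quad\text{subject to}\quad \langle w,\Phi(x_i)\rangle\ge\rho,\ i=1,\dots,n,$$ such that the binary classifier $f=\operatorname{sgn}(\langle w,\Phi(\cdot)\rangle+b):\mathbb R^D\to\{+1,-1\}$ (with $\operatorname{sgn}0=+1$), $b=-(1-\theta)\rho$, with confidence margin $m=\min_i(\langle w,\Phi(x_i)\rangle+b)$, has the following property: with probability at least $1-\delta$, if $m>0$ then for some $0\le c\le C/m$ $$P_{z\sim p_{\mathrm{data}}}\bigl(f(z)<0\bigr)\ \le\ c\,\frac{\log n}{n}+\frac1n\log\frac{n^2}{2\delta}.$$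 -/

import Mathlib

open MeasureTheory ProbabilityTheory

noncomputable section

/-- The sample space `ℝ^D` with its Euclidean norm. -/
abbrev Pt (D : ℕ) : Type := EuclideanSpace ℝ (Fin D)

/-- `P(A) ≥ q`, with `A` not required to be measurable: `A` contains a measurable set of
probability at least `q`. -/
def WithProbAtLeast {Ω : Type*} [MeasurableSpace Ω] (P : Measure Ω) (q : ℝ) (A : Set Ω) : Prop :=
  ∃ B : Set Ω, B ⊆ A ∧ MeasurableSet B ∧ ENNReal.ofReal q ≤ P B

/-- The composition `F^0 = id`, `F^(t+1) = F_t ∘ F^t` of the generating process. -/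
def flow {D : ℕ} (F : ℕ → Pt D → Pt D) : ℕ → Pt D → Pt D
  | 0 => id
  | t + 1 => F t ∘ flow F t

/-- The distribution `F^τ_♯ ρ₀` of the generated samples. -/
def generatedLaw {D : ℕ} (F : ℕ → Pt D → Pt D) (τ : ℕ) (ρ₀ : Measure (Pt D)) : Measure (Pt D) :=
  ρ₀.map (flow F τ)

/-- `T` is an `L²`-optimal transport map from `μ` to `ν`. -/
structure IsOptimalTransportMap {D : ℕ} (T : Pt D → Pt D) (μ ν : Measure (Pt D)) : Prop where
  measurable : Measurable T
  map_eq : μ.map T = ν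
  optimal : ∀ S : Pt D → Pt D, Measurable S → μ.map S = ν →
    ∫⁻ y, ENNReal.ofReal (‖T y - y‖ ^ 2) ∂μ ≤ ∫⁻ y, ENNReal.ofReal (‖S y - y‖ ^ 2) ∂μ

/-- `E t x` is the `D × d` matrix with orthonormal columns attached at time `t` to the sample path
started at `x`. It is evolved by the tangent dynamics `dF_t E_t = E_{t+1} R_t` (a QR decomposition)
from an arbitrary choice `E 0`; the columns of `E τ x` span the most sensitive `d`-dimensional
subspace at the end point `F^τ x`. -/
structure IsMostSensitiveBundle {D : ℕ} (F : ℕ → Pt D → Pt D) (τ d : ℕ)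
    (E : ℕ → Pt D → Fin d → Pt D) : Prop where
  orthonormal : ∀ t ≤ τ, ∀ x, Orthonormal ℝ (E t x)
  tangent : ∀ t < τ, ∀ x, ∃ R : Matrix (Fin d) (Fin d) ℝ, R.BlockTriangular id ∧
    ∀ j, fderiv ℝ (F t) (flow F t x) (E t x j) = ∑ i, R i j • E (t + 1) x i

/-- The tangent space at `x` to a subset `S` of `ℝ^D`: the linear span of the limits of secant
directions. For a `C¹` submanifold this is the usual tangent space. -/
def tangentSpaceOf {D : ℕ} (S : Set (Pt D)) (x : Pt D) : Submodule ℝ (Pt D) :=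
  Submodule.span ℝ (tangentConeAt ℝ S x)

/-- `(w, ρ)` solves the (hard margin) one-class support vector problem for the sample `x` and the
feature map `Φ`: minimize `‖w‖²/2 - ρ` subject to `⟪w, Φ (x i)⟫ ≥ ρ` for all `i`. -/
def IsOneClassSVM {D n : ℕ} {H : Type*} [NormedAddCommGroup H] [InnerProductSpace ℝ H]
    (Φ : Pt D → H) (x : Fin n → Pt D) (w : H) (ρ : ℝ) : Prop :=
  (∀ i, ρ ≤ inner ℝ w (Φ (x i))) ∧
    ∀ (w' : H) (ρ' : ℝ), (∀ i, ρ' ≤ inner ℝ w' (Φ (x i))) →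
      ‖w‖ ^ 2 / 2 - ρ ≤ ‖w'‖ ^ 2 / 2 - ρ'

/-- The binary classifier `sgn(⟪w, Φ z⟫ + b)`, with value `+1` on the hyperplane. -/
def kernelClassifier {D : ℕ} {H : Type*} [NormedAddCommGroup H] [InnerProductSpace ℝ H]
    (Φ : Pt D → H) (w : H) (b : ℝ) (z : Pt D) : ℤ :=
  open Classical in if 0 ≤ inner ℝ w (Φ z) + b then 1 else -1

/-- The confidence margin of `sgn(⟪w, Φ ·⟫ + b)` on a sample all of whose labels are `+1`. -/
def confidenceMargin {D n : ℕ} {H : Type*} [NormedAddCommGroup H] [InnerProductSpace ℝ H]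
    (Φ : Pt D → H) (w : H) (b : ℝ) (x : Fin n → Pt D) : ℝ :=
  ⨅ i, (inner ℝ w (Φ (x i)) + b)

end

/-!
The confidence margin is `m = θ * ρ`. If `w` keeps the sample at level `ρ`, then rescaling `w`
gives a vector `v` of squared norm at most `k * κ ^ 2`, with `k` of order `1 / m`, that separates
the sample from the region rejected at level `(1 - θ) * ρ` by a gap of width `2 * κ ^ 2`.

Draw `n ^ 2` further ghost points. At most `k` perceptron corrections, taken from the sample and the
rejected ghost points, approximate `v` closely enough to keep the separation, so the region is
described up to a small error by a record of `k` positions in the double sample. For a fixed record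
the points outside it are independent of the decoded region, of probability `a` say. Let every
accepted sample point count `1`, every rejected sample point `0`, and every rejected ghost point
`1 + u`: the expected factors `1 - a` and `1 + u * a` balance when `u` is about `1 / n`, so
the product over the unused positions has expectation at most `1`. If a region of probability
`ε` is rejected, the expected product over the ghost points is about `exp (ε * n)`. Markov's
inequality and a sum over the `(n + n ^ 2 + 1) ^ k` records and over `k < n` give the bound.
-/

open scoped ENNReal NNReal

section OneClassSVM

variable {D n : ℕ} {H : Type*} [NormedAddCommGroup H] [InnerProductSpace ℝ H]
  {Φ : Pt D → H} {x : Fin n → Pt D} {w : H} {ρ : ℝ}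

-- The solution is the point of least norm in the convex hull of the features.
theorem exists_isOneClassSVM [NeZero n] (Φ : Pt D → H) (x : Fin n → Pt D) :
    ∃ (w : H) (ρ : ℝ), IsOneClassSVM Φ x w ρ := by
  set K : Set H := convexHull ℝ (Set.range fun i => Φ (x i))
  have hΦK : ∀ i, Φ (x i) ∈ K := fun i => subset_convexHull ℝ _ ⟨i, rfl⟩
  have hcomplete : IsComplete K := ((Set.finite_range _).isCompact_convexHull ℝ).isComplete
  obtain ⟨p, hpK, hp⟩ :=
    exists_norm_eq_iInf_of_complete_convex ⟨_, hΦK 0⟩ hcomplete (convex_convexHull ℝ _) 0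
  have hvar := (norm_eq_iInf_iff_real_inner_le_zero (convex_convexHull ℝ _) hpK).1 hp
  refine ⟨p, ‖p‖ ^ 2, fun i => ?_, fun w' ρ' hfeas => ?_⟩
  · have := hvar _ (hΦK i)
    rw [zero_sub, inner_neg_left, inner_sub_right, real_inner_self_eq_norm_sq] at this
    linarith
  · have hK : K ⊆ {q | ρ' ≤ inner ℝ w' q} :=
      convexHull_min (Set.range_subset_iff.2 hfeas)
        (convex_halfSpace_ge (innerₛₗ ℝ w').isLinear ρ')
    have hρ' : ρ' ≤ inner ℝ w' p := hK hpK
    have hexpand := norm_sub_sq_real w' p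
    linarith [sq_nonneg ‖w' - p‖]

namespace IsOneClassSVM

theorem norm_sq_eq (h : IsOneClassSVM Φ x w ρ) : ‖w‖ ^ 2 = ρ := by
  -- The rescaled pairs `(s • w, s * ρ)` are feasible, so the objective is stationary at `s = 1`.
  have hmin : IsLocalMin (fun s : ℝ => s ^ 2 * (‖w‖ ^ 2 / 2) - s * ρ) 1 := by
    filter_upwards [eventually_ge_nhds one_pos] with s hs
    have hfeas : ∀ i, s * ρ ≤ inner ℝ (s • w) (Φ (x i)) := fun i => by
      rw [real_inner_smul_left]
      exact mul_le_mul_of_nonneg_left (h.1 i) hs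
    have := h.2 (s • w) (s * ρ) hfeas
    rw [norm_smul, mul_pow, Real.norm_eq_abs, sq_abs] at this
    linarith
  have hderiv : HasDerivAt (fun s : ℝ => s ^ 2 * (‖w‖ ^ 2 / 2) - s * ρ) (‖w‖ ^ 2 - ρ) 1 := by
    refine (((hasDerivAt_pow 2 (1 : ℝ)).mul_const _).sub (hasDerivAt_mul_const ρ)).congr_deriv ?_
    norm_num [mul_div_cancel₀]
  exact sub_eq_zero.1 (hmin.hasDerivAt_eq_zero hderiv)

theorem exists_inner_le [NeZero n] (h : IsOneClassSVM Φ x w ρ) :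
    ∃ i, inner ℝ w (Φ (x i)) ≤ ρ := by
  obtain ⟨i, hi⟩ := Finite.exists_min fun i => inner ℝ w (Φ (x i))
  exact ⟨i, by linarith [h.2 w _ hi]⟩

theorem confidenceMargin_eq [NeZero n] (h : IsOneClassSVM Φ x w ρ) (b : ℝ) :
    confidenceMargin Φ w b x = ρ + b := by
  obtain ⟨i, hi⟩ := h.exists_inner_le
  refine le_antisymm ?_ (le_ciInf fun j => by linarith [h.1 j])
  exact (ciInf_le (Set.finite_range _).bddBelow i).trans (by linarith)

end IsOneClassSVM

end OneClassSVM

section Perceptron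

variable {ι H : Type*} [NormedAddCommGroup H] [InnerProductSpace ℝ H]

-- As in Novikoff's argument, subtracting a `ψ i` whose inner product with the residual is at least
-- `κ ^ 2` lowers the squared norm of the residual by at least `κ ^ 2`.
theorem exists_inner_sub_sum_lt (ψ : ι → H) {κ : ℝ} (hκ : 0 < κ) {k : ℕ} {v : H}
    (hv : ‖v‖ ^ 2 ≤ k * κ ^ 2) :
    ∃ s : Fin k → Option ι,
      ∀ i, ‖ψ i‖ ≤ κ → inner ℝ (v - ∑ j, (s j).elim 0 ψ) (ψ i) < κ ^ 2 := by
  induction k generalizing v with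
  | zero =>
    have hv0 : v = 0 := by simpa using hv
    exact ⟨Fin.elim0, fun i _ => by simpa [hv0] using pow_pos hκ 2⟩
  | succ k ih =>
    by_cases hdone : ∀ i, ‖ψ i‖ ≤ κ → inner ℝ v (ψ i) < κ ^ 2
    · exact ⟨fun _ => none, by simpa using hdone⟩
    push Not at hdone
    obtain ⟨i, hψi, hvi⟩ := hdone
    have hdecrease : ‖v - ψ i‖ ^ 2 ≤ k * κ ^ 2 := by
      have : ‖ψ i‖ ^ 2 ≤ κ ^ 2 := by gcongr
      rw [norm_sub_sq_real]
      push_cast at hv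
      linarith
    obtain ⟨s, hs⟩ := ih hdecrease
    exact ⟨Fin.cons (some i) s, by simpa [Fin.sum_univ_succ, sub_sub] using hs⟩

end Perceptron

section Product

variable {ι : Type*} [Fintype ι] {Z : ι → Type*} [∀ i, MeasurableSpace (Z i)]

theorem lintegral_pi_prod (μ : ∀ i, Measure (Z i)) [∀ i, IsProbabilityMeasure (μ i)]
    {c : ∀ i, Z i → ℝ≥0∞} (hc : ∀ i, Measurable (c i)) :
    ∫⁻ z, ∏ i, c i (z i) ∂(Measure.pi μ) = ∏ i, ∫⁻ y, c i y ∂(μ i) := by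
  rw [lintegral_prod_eq_prod_lintegral_of_indepFun Finset.univ (fun i (z : ∀ i, Z i) => c i (z i))
    (iIndepFun_pi fun i => (hc i).aemeasurable) fun i => (hc i).comp (measurable_pi_apply i)]
  exact Finset.prod_congr rfl fun i _ => (measurePreserving_eval μ i).lintegral_comp (hc i)

theorem lintegral_pi_prod_compl_le [DecidableEq ι] (μ : ∀ i, Measure (Z i))
    [∀ i, IsProbabilityMeasure (μ i)] (S : Finset ι) {c : (∀ i, Z i) → ∀ i, Z i → ℝ≥0∞}
    (hdep : DependsOn c S) (hc : ∀ z i, Measurable (c z i))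
    (hcz : ∀ i, Measurable fun z : ∀ i, Z i => c z i (z i)) {B : ℝ≥0∞}
    (hB : ∀ z, ∏ i ∈ Sᶜ, ∫⁻ y, c z i y ∂(μ i) ≤ B) :
    ∫⁻ z, ∏ i ∈ Sᶜ, c z i (z i) ∂(Measure.pi μ) ≤ B := by
  have hmeas : Measurable fun z : ∀ i, Z i => ∏ i ∈ Sᶜ, c z i (z i) :=
    Finset.measurable_prod _ fun i _ => hcz i
  refine (lintegral_le_of_lmarginal_le Sᶜ hmeas (measurable_const (a := B))
    fun z => ?_).trans_eq (by simp)
  have hfree : ∀ y : ∀ i : (Sᶜ : Finset ι), Z i,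
      ∏ i ∈ Sᶜ, c (Function.updateFinset z Sᶜ y) i (Function.updateFinset z Sᶜ y i) =
        ∏ i : (Sᶜ : Finset ι), c z i (y i) := fun y => by
    have hcy : c (Function.updateFinset z Sᶜ y) = c z :=
      hdep fun i hi => by simp_all [Function.updateFinset]
    rw [hcy, ← Finset.prod_coe_sort]
    exact Finset.prod_congr rfl fun i _ => by simp [Function.updateFinset]
  calc (∫⋯∫⁻_Sᶜ, fun z => ∏ i ∈ Sᶜ, c z i (z i) ∂μ) z
      = ∏ i : (Sᶜ : Finset ι), ∫⁻ y, c z i y ∂(μ i) := by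
        simp only [lmarginal, hfree]
        exact lintegral_pi_prod _ fun i => hc z i
    _ = ∏ i ∈ Sᶜ, ∫⁻ y, c z i y ∂(μ i) := Finset.prod_coe_sort Sᶜ fun i => ∫⁻ y, c z i y ∂(μ i)
    _ ≤ B := hB z
    _ = (∫⋯∫⁻_Sᶜ, fun _ => B ∂μ) z := by simp [lmarginal]

end Product

section DoubleSample

variable {α β Z : Type*} [MeasurableSpace Z]

theorem measurable_sumElim : Measurable fun p : (α → Z) × (β → Z) => Sum.elim p.1 p.2 :=
  measurable_pi_iff.2 <| Sum.rec (fun i => by simp only [Sum.elim_inl]; fun_prop)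
    fun j => by simp only [Sum.elim_inr]; fun_prop

theorem lintegral_lintegral_sumElim [Fintype α] [Fintype β] (μ : α ⊕ β → Measure Z)
    [∀ i, SigmaFinite (μ i)] {f : (α ⊕ β → Z) → ℝ≥0∞} (hf : Measurable f) :
    ∫⁻ x, ∫⁻ g, f (Sum.elim x g) ∂(Measure.pi fun j => μ (.inr j)) ∂(Measure.pi fun i => μ (.inl i))
      = ∫⁻ z, f z ∂(Measure.pi μ) := by
  rw [← (measurePreserving_sumPiEquivProdPi_symm μ).lintegral_comp hf]
  exact (lintegral_prod _ (hf.comp measurable_sumElim).aemeasurable).symm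

end DoubleSample

section Ghost

variable {α β Z H : Type*} [NormedAddCommGroup H] {Φ : Z → H} {k : ℕ}

/-- The perceptron corrections offered by a double sample: to push a normal vector up at the points
of the first sample and down at the points of the ghost sample. -/
def signedFeature (Φ : Z → H) (z : α ⊕ β → Z) : α ⊕ β → H :=
  Sum.elim (fun i => Φ (z (.inl i))) fun j => -Φ (z (.inr j))

/-- The vector that a compression record `s` decodes to from the double sample `z`: the sum of the
corrections at the positions listed in `s`, where `none` pads the record to length `k`. -/
def correctionSum (Φ : Z → H) (s : Fin k → Option (α ⊕ β)) (z : α ⊕ β → Z) : H :=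
  ∑ j, (s j).elim 0 (signedFeature Φ z)

/-- The positions listed in a compression record. -/
def usedIndices {ι : Type*} [DecidableEq ι] (s : Fin k → Option ι) : Finset ι :=
  (Finset.univ.image s).eraseNone

/-- The region cut off by the half-space with normal vector `q` and threshold `t`. -/
def rejectedSet [InnerProductSpace ℝ H] (Φ : Z → H) (t : ℝ) (q : H) : Set Z :=
  {y | inner ℝ q (Φ y) < t}

/-- The factor that one point contributes to `recordWeight`: a point of the first sample must avoid
`A`, while a ghost point is rewarded by the factor `1 + u` for lying in `A`. -/
noncomputable def pointWeight (A : Set Z) (u : ℝ≥0) : α ⊕ β → Z → ℝ≥0∞ :=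
  Sum.elim (fun _ => Aᶜ.indicator 1) fun _ => 1 + A.indicator fun _ => (u : ℝ≥0∞)

/-- The likelihood-ratio type statistic of a compression record: the product of the point weights of
the region rejected by the decoded vector, over the positions not listed in the record. -/
noncomputable def recordWeight [InnerProductSpace ℝ H] [Fintype α] [Fintype β] [DecidableEq α]
    [DecidableEq β] (Φ : Z → H) (t : ℝ) (u : ℝ≥0) (s : Fin k → Option (α ⊕ β)) (z : α ⊕ β → Z) :
    ℝ≥0∞ :=
  ∏ i ∈ (usedIndices s)ᶜ, pointWeight (rejectedSet Φ t (correctionSum Φ s z)) u i (z i)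

theorem mem_usedIndices {ι : Type*} [DecidableEq ι] {s : Fin k → Option ι} {i : ι} :
    i ∈ usedIndices s ↔ ∃ j, s j = some i := by
  simp [usedIndices]

theorem card_usedIndices_le {ι : Type*} [DecidableEq ι] (s : Fin k → Option ι) :
    (usedIndices s).card ≤ k :=
  calc (usedIndices s).card ≤ (Finset.univ.image s).card := Finset.card_eraseNone_le _
    _ ≤ k := Finset.card_image_le.trans_eq (by simp)

theorem dependsOn_correctionSum [DecidableEq α] [DecidableEq β] (Φ : Z → H)
    (s : Fin k → Option (α ⊕ β)) : DependsOn (correctionSum Φ s) (usedIndices s) := by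
  intro z z' hz
  refine Finset.sum_congr rfl fun j _ => ?_
  rcases hj : s j with _ | i | i
  · rfl
  all_goals
    have := hz _ (mem_usedIndices.2 ⟨j, hj⟩)
    simp [signedFeature, this]

theorem measurable_pointWeight_comp {Y : Type*} [MeasurableSpace Y] {A : Y → Set Z} {g : Y → Z}
    (hA : MeasurableSet {y | g y ∈ A y}) (u : ℝ≥0) (i : α ⊕ β) :
    Measurable fun y => pointWeight (A y) u i (g y) := by
  rcases i with _ | _
  · exact (measurable_const (a := (1 : ℝ≥0∞))).indicator hA.compl
  · exact measurable_const.add ((measurable_const (a := (u : ℝ≥0∞))).indicator hA)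

variable [MeasurableSpace Z]

theorem stronglyMeasurable_correctionSum (hΦ : StronglyMeasurable Φ)
    (s : Fin k → Option (α ⊕ β)) : StronglyMeasurable (correctionSum Φ s) := by
  refine Finset.stronglyMeasurable_fun_sum _ fun j _ => ?_
  rcases s j with _ | i | i
  · exact stronglyMeasurable_const
  · exact hΦ.comp_measurable (measurable_pi_apply _)
  · exact (hΦ.comp_measurable (measurable_pi_apply _)).neg

variable [InnerProductSpace ℝ H]

theorem measurableSet_rejectedSet {Y : Type*} [MeasurableSpace Y] (hΦ : StronglyMeasurable Φ)
    (t : ℝ) {q : Y → H} (hq : StronglyMeasurable q) {g : Y → Z} (hg : Measurable g) :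
    MeasurableSet {y | g y ∈ rejectedSet Φ t (q y)} :=
  (hq.inner (hΦ.comp_measurable hg)).measurable measurableSet_Iio

theorem lintegral_pointWeight_le (μ : Measure Z) [IsProbabilityMeasure μ] {A : Set Z}
    (hA : MeasurableSet A) (u : ℝ≥0) (i : α ⊕ β) :
    ∫⁻ y, pointWeight A u i y ∂μ ≤ ENNReal.ofReal (Real.exp
      (Sum.elim (fun _ => -μ.real A) (fun _ => u * μ.real A) i)) := by
  rcases i with i | j
  · calc ∫⁻ y, pointWeight A u (.inl i : α ⊕ β) y ∂μ = μ Aᶜ := lintegral_indicator_one hA.compl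
      _ = ENNReal.ofReal (1 - μ.real A) := by
        rw [← probReal_compl_eq_one_sub hA, ofReal_measureReal]
      _ ≤ _ := ENNReal.ofReal_le_ofReal (Real.one_sub_le_exp_neg _)
  · calc ∫⁻ y, pointWeight A u (.inr j : α ⊕ β) y ∂μ = 1 + u * μ A := by
          simp [pointWeight, lintegral_add_left, lintegral_indicator_const hA]
      _ = ENNReal.ofReal (u * μ.real A + 1) := by
        rw [ENNReal.ofReal_add (by positivity) zero_le_one, ENNReal.ofReal_mul u.coe_nonneg,
          ofReal_measureReal, ENNReal.ofReal_coe_nnreal, ENNReal.ofReal_one, add_comm]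
      _ ≤ _ := ENNReal.ofReal_le_ofReal (Real.add_one_le_exp _)

variable [Fintype α] [Fintype β] [DecidableEq α] [DecidableEq β]

theorem sum_compl_sumElim_nonpos (S : Finset (α ⊕ β)) {u b : ℝ} (hu : 0 ≤ u) (hb : 0 ≤ b)
    (hS : u * Fintype.card β + S.card ≤ Fintype.card α) :
    ∑ i ∈ Sᶜ, Sum.elim (fun _ : α => -b) (fun _ : β => u * b) i ≤ 0 := by
  set g := Sum.elim (fun _ : α => -b) (fun _ : β => u * b)
  have htotal : ∑ i, g i = (u * Fintype.card β - Fintype.card α) * b := by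
    simp only [g, Fintype.sum_sum_type, Sum.elim_inl, Sum.elim_inr, Finset.sum_const,
      Finset.card_univ, nsmul_eq_mul]
    ring
  have hused : S.card * -b ≤ ∑ i ∈ S, g i := by
    rw [← nsmul_eq_mul]
    refine Finset.card_nsmul_le_sum _ _ _ fun i _ => ?_
    rcases i with i | j
    · exact le_rfl
    · exact (neg_nonpos.2 hb).trans (mul_nonneg hu hb)
  have hsplit := Finset.sum_add_sum_compl S g
  nlinarith [mul_le_mul_of_nonneg_right hS hb]

theorem measurable_recordWeight (hΦ : StronglyMeasurable Φ) (t : ℝ) (u : ℝ≥0)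
    (s : Fin k → Option (α ⊕ β)) : Measurable (recordWeight Φ t u s) :=
  Finset.measurable_prod _ fun i _ => measurable_pointWeight_comp
    (measurableSet_rejectedSet hΦ t (stronglyMeasurable_correctionSum hΦ s)
      (measurable_pi_apply i)) u i

-- The points outside the record are independent of the region that the record decodes to.
theorem lintegral_recordWeight_le_one (μ : Measure Z) [IsProbabilityMeasure μ]
    (hΦ : StronglyMeasurable Φ) (t : ℝ) {u : ℝ≥0} (hu : u * Fintype.card β + k ≤ Fintype.card α)
    (s : Fin k → Option (α ⊕ β)) :
    ∫⁻ z, recordWeight Φ t u s z ∂(Measure.pi fun _ => μ) ≤ 1 := by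
  set A : (α ⊕ β → Z) → Set Z := fun z => rejectedSet Φ t (correctionSum Φ s z)
  have hA : ∀ z, MeasurableSet (A z) := fun z =>
    measurableSet_rejectedSet hΦ t stronglyMeasurable_const measurable_id
  have hS : (u : ℝ) * Fintype.card β + (usedIndices s).card ≤ Fintype.card α := by
    have : ((usedIndices s).card : ℝ) ≤ k := mod_cast card_usedIndices_le s
    have : (u : ℝ) * Fintype.card β + k ≤ Fintype.card α := mod_cast hu
    linarith
  refine lintegral_pi_prod_compl_le (fun _ => μ) (usedIndices s)
    (c := fun z i => pointWeight (A z) u i) ?_ (fun z i => ?_) (fun i => ?_) fun z => ?_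
  · exact fun z z' hz => by simp only [A, dependsOn_correctionSum Φ s hz]
  · exact measurable_pointWeight_comp (A := fun _ => A z) (g := id) (hA z) u i
  · exact measurable_pointWeight_comp (measurableSet_rejectedSet hΦ t
      (stronglyMeasurable_correctionSum hΦ s) (measurable_pi_apply i)) u i
  · calc ∏ i ∈ (usedIndices s)ᶜ, ∫⁻ y, pointWeight (A z) u i y ∂μ
        ≤ ∏ i ∈ (usedIndices s)ᶜ, ENNReal.ofReal (Real.exp
            (Sum.elim (fun _ => -μ.real (A z)) (fun _ => u * μ.real (A z)) i)) :=
          Finset.prod_le_prod' fun i _ => lintegral_pointWeight_le μ (hA z) u i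
      _ ≤ 1 := by
          rw [← ENNReal.ofReal_prod_of_nonneg fun i _ => (Real.exp_pos _).le, ← Real.exp_sum,
            ENNReal.ofReal_le_one, Real.exp_le_one_iff]
          exact sum_compl_sumElim_nonpos _ u.2 measureReal_nonneg hS

end Ghost

section SeparableSamples

variable {α β Z H : Type*} [NormedAddCommGroup H] [InnerProductSpace ℝ H] {Φ : Z → H} {k : ℕ}

/-- The samples that some vector `v` with `‖v‖ ^ 2 ≤ k * κ ^ 2` separates from a region of
probability at least `ε`, leaving a gap of width `2 * κ ^ 2` centred at `t`. -/
def separableSamples [MeasurableSpace Z] (α : Type*) (Φ : Z → H) (μ : Measure Z) (κ t ε : ℝ)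
    (k : ℕ) : Set (α → Z) :=
  {x | ∃ v : H, ‖v‖ ^ 2 ≤ k * κ ^ 2 ∧
    (∀ i, ‖Φ (x i)‖ ≤ κ ∧ t + κ ^ 2 ≤ inner ℝ v (Φ (x i))) ∧
    ε ≤ μ.real ({y | ‖Φ y‖ ≤ κ} ∩ rejectedSet Φ (t - κ ^ 2) v)}

theorem exists_correctionSum_near (Φ : Z → H) (x : α → Z) (g : β → Z) {κ : ℝ} (hκ : 0 < κ) {v : H}
    (hv : ‖v‖ ^ 2 ≤ k * κ ^ 2) :
    ∃ s : Fin k → Option (α ⊕ β),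
      (∀ i, ‖Φ (x i)‖ ≤ κ →
        inner ℝ v (Φ (x i)) - κ ^ 2 < inner ℝ (correctionSum Φ s (Sum.elim x g)) (Φ (x i))) ∧
      ∀ j, ‖Φ (g j)‖ ≤ κ →
        inner ℝ (correctionSum Φ s (Sum.elim x g)) (Φ (g j)) < inner ℝ v (Φ (g j)) + κ ^ 2 := by
  obtain ⟨s, hs⟩ := exists_inner_sub_sum_lt (signedFeature Φ (Sum.elim x g)) hκ hv
  refine ⟨s, fun i hi => ?_, fun j hj => ?_⟩
  · have : inner ℝ (v - correctionSum Φ s (Sum.elim x g)) (Φ (x i)) < κ ^ 2 := hs (.inl i) hi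
    rw [inner_sub_left] at this
    linarith
  · have : inner ℝ (v - correctionSum Φ s (Sum.elim x g)) (-Φ (g j)) < κ ^ 2 :=
      hs (.inr j) ((norm_neg _).trans_le hj)
    rw [inner_neg_right, inner_sub_left] at this
    linarith

theorem pointWeight_le (A : Set Z) (u : ℝ≥0) (i : α ⊕ β) (y : Z) :
    pointWeight A u i y ≤ 1 + u := by
  rcases i with _ | _
  · exact (Set.indicator_le_self _ _ y).trans le_self_add
  · exact add_le_add_right (Set.indicator_le_self A (fun _ => (u : ℝ≥0∞)) y) 1

variable [Fintype α] [Fintype β]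

theorem prod_one_add_indicator_le_recordWeight [DecidableEq α] [DecidableEq β] {t : ℝ}
    (u : ℝ≥0) {s : Fin k → Option (α ⊕ β)} {x : α → Z} {g : β → Z} {B : Set Z}
    (hacc : ∀ i, x i ∉ rejectedSet Φ t (correctionSum Φ s (Sum.elim x g)))
    (hrej : ∀ j, g j ∈ B → g j ∈ rejectedSet Φ t (correctionSum Φ s (Sum.elim x g))) :
    ∏ j, (1 + B.indicator (fun _ => (u : ℝ≥0∞)) (g j)) ≤
      (1 + u) ^ k * recordWeight Φ t u s (Sum.elim x g) := by
  set A := rejectedSet Φ t (correctionSum Φ s (Sum.elim x g))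
  calc ∏ j, (1 + B.indicator (fun _ => (u : ℝ≥0∞)) (g j))
      ≤ ∏ j, pointWeight A u (.inr j : α ⊕ β) (g j) := by
        refine Finset.prod_le_prod' fun j _ => add_le_add_right ?_ 1
        by_cases hj : g j ∈ B <;> simp [hj, hrej]
    _ = ∏ i, pointWeight A u i (Sum.elim x g i) := by
        simp [Fintype.prod_sum_type, pointWeight, hacc]
    _ = (∏ i ∈ usedIndices s, pointWeight A u i (Sum.elim x g i)) *
          recordWeight Φ t u s (Sum.elim x g) :=
        (Finset.prod_mul_prod_compl _ _).symm
    _ ≤ (1 + u) ^ (usedIndices s).card * recordWeight Φ t u s (Sum.elim x g) := by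
        gcongr
        exact Finset.prod_le_pow_card _ _ _ fun i _ => pointWeight_le A u i (Sum.elim x g i)
    _ ≤ (1 + u) ^ k * recordWeight Φ t u s (Sum.elim x g) := by
        gcongr
        · exact le_self_add
        · exact card_usedIndices_le s

variable [MeasurableSpace Z] {μ : Measure Z} [IsProbabilityMeasure μ] {κ t ε : ℝ}

theorem pow_le_lintegral_sum_recordWeight [DecidableEq α] [DecidableEq β]
    (hΦ : StronglyMeasurable Φ) (hκ : 0 < κ) (u : ℝ≥0) {x : α → Z}
    (hx : x ∈ separableSamples α Φ μ κ t ε k) :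
    (1 + u * ENNReal.ofReal ε) ^ Fintype.card β ≤
      (1 + u) ^ k * ∫⁻ g : β → Z, ∑ s : Fin k → Option (α ⊕ β),
        recordWeight Φ t u s (Sum.elim x g) ∂(Measure.pi fun _ => μ) := by
  obtain ⟨v, hv, hxv, hε⟩ := hx
  set B := {y | ‖Φ y‖ ≤ κ} ∩ rejectedSet Φ (t - κ ^ 2) v
  have hB : MeasurableSet B := (hΦ.norm.measurable measurableSet_Iic).inter
    (measurableSet_rejectedSet hΦ _ stronglyMeasurable_const measurable_id)
  have hrecord : ∀ g : β → Z, ∏ j, (1 + B.indicator (fun _ => (u : ℝ≥0∞)) (g j)) ≤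
      (1 + u) ^ k * ∑ s : Fin k → Option (α ⊕ β), recordWeight Φ t u s (Sum.elim x g) := by
    intro g
    obtain ⟨s, hacc, hrej⟩ := exists_correctionSum_near Φ x g hκ hv
    have hsum := Finset.single_le_sum_of_canonicallyOrdered
      (f := fun s => recordWeight Φ t u s (Sum.elim x g)) (Finset.mem_univ s)
    refine (prod_one_add_indicator_le_recordWeight u (fun i => ?_) fun j hj => ?_).trans
      (mul_le_mul_right hsum _)
    · exact not_lt_of_ge <| (le_sub_iff_add_le.2 (hxv i).2).trans (hacc i (hxv i).1).le
    · exact (hrej j hj.1).trans (lt_sub_iff_add_lt.1 hj.2)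
  calc (1 + u * ENNReal.ofReal ε) ^ Fintype.card β
      ≤ (1 + u * μ B) ^ Fintype.card β := by
        gcongr
        exact (ENNReal.ofReal_le_ofReal hε).trans_eq ofReal_measureReal
    _ = ∫⁻ g : β → Z, ∏ j, (1 + B.indicator (fun _ => (u : ℝ≥0∞)) (g j))
          ∂(Measure.pi fun _ => μ) := by
        rw [lintegral_pi_prod (fun _ => μ) (c := fun _ y => 1 + B.indicator (fun _ => (u : ℝ≥0∞)) y)
          fun _ => measurable_const.add (measurable_const.indicator hB)]
        simp [lintegral_add_left, lintegral_indicator_const hB]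
    _ ≤ _ := by
        rw [← lintegral_const_mul' _ _ (by finiteness)]
        exact lintegral_mono hrecord

theorem measureReal_separableSamples_mul_le (hΦ : StronglyMeasurable Φ) (hκ : 0 < κ)
    (hε : 0 ≤ ε) {u : ℝ≥0} (hu : u * Fintype.card β + k ≤ Fintype.card α) :
    (1 + u * ε) ^ Fintype.card β *
        (Measure.pi fun _ => μ).real (separableSamples α Φ μ κ t ε k) ≤
      (1 + u) ^ k * (Fintype.card α + Fintype.card β + 1) ^ k := by
  classical
  set G : (α → Z) → ℝ≥0∞ := fun x => (1 + u) ^ k * ∫⁻ g : β → Z,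
    ∑ s : Fin k → Option (α ⊕ β), recordWeight Φ t u s (Sum.elim x g) ∂(Measure.pi fun _ => μ)
  have hweight : Measurable fun z : α ⊕ β → Z =>
      ∑ s : Fin k → Option (α ⊕ β), recordWeight Φ t u s z :=
    Finset.measurable_fun_sum _ fun s _ => measurable_recordWeight hΦ t u s
  have hG : Measurable G :=
    ((hweight.comp measurable_sumElim).lintegral_prod_right').const_mul _
  have hmarkov : (1 + u * ENNReal.ofReal ε) ^ Fintype.card β *
      (Measure.pi fun _ => μ) (separableSamples α Φ μ κ t ε k) ≤
        (1 + u) ^ k * (Fintype.card α + Fintype.card β + 1) ^ k :=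
    calc _ ≤ ∫⁻ x, G x ∂(Measure.pi fun _ => μ) := by
          refine (mul_le_mul_right (measure_mono fun x hx => ?_) _).trans
            (mul_meas_ge_le_lintegral hG _)
          exact pow_le_lintegral_sum_recordWeight hΦ hκ u hx
      _ = (1 + u) ^ k * ∑ s : Fin k → Option (α ⊕ β),
            ∫⁻ z, recordWeight Φ t u s z ∂(Measure.pi fun _ => μ) := by
          rw [lintegral_const_mul' _ _ (by finiteness),
            lintegral_lintegral_sumElim (fun _ => μ) hweight,
            lintegral_finsetSum _ fun s _ => measurable_recordWeight hΦ t u s]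
      _ ≤ (1 + u) ^ k * ∑ s : Fin k → Option (α ⊕ β), 1 := by
          gcongr with s
          exact lintegral_recordWeight_le_one μ hΦ t hu s
      _ = _ := by simp
  simpa [ENNReal.toReal_add, ENNReal.toReal_ofReal hε, ENNReal.mul_eq_top, measureReal_def] using
    ENNReal.toReal_mono (by finiteness) hmarkov

end SeparableSamples

section Tail

theorem exp_sub_sq_div_le_one_add_div_pow {x : ℝ} (hx : 0 ≤ x) {N : ℕ} (hN : N ≠ 0) :
    Real.exp (x - x ^ 2 / (2 * N)) ≤ (1 + x / N) ^ N := by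
  set y := x / N with hy
  have hy0 : 0 ≤ y := by positivity
  have hquad : y - y ^ 2 / 2 ≤ 2 * y / (y + 2) := by
    rw [le_div_iff₀ (by positivity)]
    nlinarith [pow_nonneg hy0 3]
  rw [← Real.le_log_iff_exp_le (by positivity), Real.log_pow]
  calc x - x ^ 2 / (2 * N) = N * (y - y ^ 2 / 2) := by rw [hy]; field_simp
    _ ≤ N * Real.log (1 + y) := by
      gcongr
      exact hquad.trans (Real.le_log_one_add_of_nonneg hy0)

theorem exp_le_one_add_mul_pow {n : ℕ} {k u ε : ℝ} (hk : 0 ≤ k) (hkn : k ≤ n)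
    (hu : u * n ^ 2 = n - k) (hn : n ≠ 0) (hε : 0 ≤ ε) (hε1 : ε ≤ 1) :
    Real.exp (ε * n - k - 1 / 2) ≤ (1 + u * ε) ^ n ^ 2 := by
  set x := (n - k) * ε with hx
  have hx0 : 0 ≤ x := mul_nonneg (sub_nonneg.2 hkn) hε
  have hxn : x ≤ n := (mul_le_of_le_one_right (sub_nonneg.2 hkn) hε1).trans (sub_le_self _ hk)
  have hxε : ε * n - k ≤ x := by linarith [mul_le_of_le_one_right hk hε1]
  have hdiv : x / (n ^ 2 : ℕ) = u * ε := by
    rw [hx, ← hu]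
    push_cast
    field_simp
  have hsq : x ^ 2 / (2 * (n ^ 2 : ℕ)) ≤ 1 / 2 := by
    rw [div_le_div_iff₀ (by positivity) two_pos]
    push_cast
    linarith [pow_le_pow_left₀ hx0 hxn 2]
  calc Real.exp (ε * n - k - 1 / 2) ≤ Real.exp (x - x ^ 2 / (2 * (n ^ 2 : ℕ))) := by
        gcongr
    _ ≤ (1 + u * ε) ^ n ^ 2 :=
        hdiv ▸ exp_sub_sq_div_le_one_add_div_pow hx0 (pow_ne_zero 2 hn)

theorem pow_mul_pow_le_exp {n : ℕ} (hn : 2 ≤ n) {u : ℝ} (hu0 : 0 ≤ u) (hu : u * n ≤ 1) (k : ℕ) :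
    (1 + u) ^ k * (n + n ^ 2 + 1) ^ k ≤ Real.exp (4 * k * Real.log n) := by
  have hn' : (2 : ℝ) ≤ n := mod_cast hn
  have hu2 : u ≤ 1 / 2 := by nlinarith
  have hbase : (1 + u) * (n + n ^ 2 + 1) ≤ (n : ℝ) ^ 4 :=
    calc (1 + u) * (n + n ^ 2 + 1) ≤ (1 + 1 / 2) * (n + n ^ 2 + 1) := by gcongr
      _ ≤ 4 * (n : ℝ) ^ 2 := by nlinarith
      _ ≤ n ^ 2 * n ^ 2 := by gcongr; nlinarith
      _ = n ^ 4 := by ring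
  calc (1 + u) ^ k * (n + n ^ 2 + 1) ^ k ≤ ((n : ℝ) ^ 4) ^ k := by rw [← mul_pow]; gcongr
    _ = Real.exp (4 * k * Real.log n) := by
        rw [← pow_mul, ← Real.exp_log (pow_pos (two_pos.trans_le hn') _), Real.log_pow]
        push_cast
        rfl

/-- The error level at which the union bound over records of length `k` is run. -/
noncomputable def errorBound (n : ℕ) (δ k : ℝ) : ℝ :=
  7 * k * (Real.log n / n) + Real.log (n ^ 2 / (2 * δ)) / n

theorem log_two_le_log_natCast {n : ℕ} (hn : 2 ≤ n) : Real.log 2 ≤ Real.log n :=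
  Real.log_le_log two_pos (mod_cast hn)

theorem log_sq_div_eq {n : ℕ} (hn : n ≠ 0) {δ : ℝ} (hδ : 0 < δ) :
    Real.log ((n : ℝ) ^ 2 / (2 * δ)) = 2 * Real.log n - Real.log 2 - Real.log δ := by
  rw [Real.log_div (by positivity) (by positivity), Real.log_pow, Real.log_mul two_ne_zero hδ.ne']
  push_cast
  ring

theorem errorBound_nonneg {n : ℕ} (hn : 2 ≤ n) {δ : ℝ} (hδ : 0 < δ) (hδ1 : δ ≤ 1) {k : ℝ}
    (hk : 0 ≤ k) : 0 ≤ errorBound n δ k := by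
  have hlog2 := Real.log_pos one_lt_two
  have hlogn := log_two_le_log_natCast hn
  have hL : 0 ≤ Real.log ((n : ℝ) ^ 2 / (2 * δ)) := by
    rw [log_sq_div_eq (by omega) hδ]
    linarith [Real.log_nonpos hδ.le hδ1]
  have : 0 ≤ Real.log n := by linarith
  unfold errorBound
  positivity

theorem exp_sub_errorBound_mul_le {n k : ℕ} (hn : 2 ≤ n) (hk : 1 ≤ k) {δ : ℝ} (hδ : 0 < δ) :
    Real.exp (4 * k * Real.log n + k + 1 / 2 - errorBound n δ k * n) ≤ δ / n := by
  have hk' : (1 : ℝ) ≤ k := mod_cast hk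
  have hlog2 := Real.log_two_gt_d9
  have hlogn := log_two_le_log_natCast hn
  have hmul : errorBound n δ k * n =
      7 * k * Real.log n + (2 * Real.log n - Real.log 2 - Real.log δ) := by
    rw [← log_sq_div_eq (by omega) hδ, errorBound]
    field_simp
  rw [← Real.le_log_iff_exp_le (by positivity), Real.log_div hδ.ne' (by positivity), hmul]
  nlinarith

variable {Z H : Type*} [NormedAddCommGroup H] [InnerProductSpace ℝ H] {Φ : Z → H}
  [MeasurableSpace Z] {μ : Measure Z} [IsProbabilityMeasure μ] {κ t ε δ : ℝ} {n k : ℕ}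

theorem measureReal_separableSamples_le_exp (hΦ : StronglyMeasurable Φ) (hκ : 0 < κ) (hn : 2 ≤ n)
    (hk : k ≤ n) (hε : 0 ≤ ε) :
    (Measure.pi fun _ => μ).real (separableSamples (Fin n) Φ μ κ t ε k) ≤
      Real.exp (4 * k * Real.log n + k + 1 / 2 - ε * n) := by
  rcases lt_or_ge 1 ε with hε1 | hε1
  · have hempty : separableSamples (Fin n) Φ μ κ t ε k = ∅ :=
      Set.eq_empty_of_forall_notMem fun x ⟨_, _, _, h⟩ => absurd h <|
        not_le.2 (measureReal_le_one.trans_lt hε1)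
    simpa [hempty] using (Real.exp_pos _).le
  have hkn : (k : ℝ) ≤ n := mod_cast hk
  set p := (Measure.pi fun _ => μ).real (separableSamples (Fin n) Φ μ κ t ε k)
  -- The largest reward compatible with `lintegral_recordWeight_le_one` for `n ^ 2` ghost points.
  obtain ⟨u, hu⟩ : ∃ u : ℝ≥0, (u : ℝ) * n ^ 2 = n - k :=
    ⟨⟨(n - k) / n ^ 2, div_nonneg (sub_nonneg.2 hkn) (by positivity)⟩,
      div_mul_cancel₀ _ (by positivity)⟩
  have hu_le : (u : ℝ) * n ≤ 1 := by
    refine le_of_mul_le_mul_right ?_ (show (0 : ℝ) < n by positivity)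
    linarith [k.cast_nonneg (α := ℝ)]
  have hghost : (1 + u * ε) ^ n ^ 2 * p ≤ (1 + u) ^ k * (n + n ^ 2 + 1) ^ k := by
    have hcard : u * Fintype.card (Fin (n ^ 2)) + k ≤ Fintype.card (Fin n) := by
      rw [← NNReal.coe_le_coe]
      push_cast [Fintype.card_fin]
      linarith
    simpa using measureReal_separableSamples_mul_le (μ := μ) (t := t) hΦ hκ hε hcard
  have hreward := exp_le_one_add_mul_pow k.cast_nonneg hkn hu (by omega) hε hε1
  have hcost := pow_mul_pow_le_exp hn u.2 hu_le k
  calc p = Real.exp (-(ε * n - k - 1 / 2)) * (Real.exp (ε * n - k - 1 / 2) * p) := by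
        rw [← mul_assoc, ← Real.exp_add]; simp
    _ ≤ Real.exp (-(ε * n - k - 1 / 2)) * Real.exp (4 * k * Real.log n) := by
        gcongr
        exact (mul_le_mul_of_nonneg_right hreward measureReal_nonneg).trans (hghost.trans hcost)
    _ = _ := by rw [← Real.exp_add]; ring_nf

theorem measureReal_separableSamples_errorBound_le (hΦ : StronglyMeasurable Φ) (hκ : 0 < κ)
    (hn : 2 ≤ n) (hk : k ∈ Finset.Ico 1 n) (hδ : 0 < δ) (hδ1 : δ ≤ 1) :
    (Measure.pi fun _ => μ).real (separableSamples (Fin n) Φ μ κ t (errorBound n δ k) k) ≤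
      δ / n := by
  obtain ⟨hk1, hkn⟩ := Finset.mem_Ico.1 hk
  exact (measureReal_separableSamples_le_exp hΦ hκ hn hkn.le
    (errorBound_nonneg hn hδ hδ1 k.cast_nonneg)).trans (exp_sub_errorBound_mul_le hn hk1 hδ)

end Tail

section Margin

variable {Z H : Type*} [NormedAddCommGroup H] [InnerProductSpace ℝ H] {Φ : Z → H} {w : H}

theorem rejectedSet_smul (Φ : Z → H) (t : ℝ) {a : ℝ} (ha : 0 < a) :
    rejectedSet Φ (a * t) (a • w) = rejectedSet Φ t w := by
  ext y
  simp only [rejectedSet, Set.mem_ofPred_eq, real_inner_smul_left, mul_lt_mul_iff_right₀ ha]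

variable [MeasurableSpace Z] {μ : Measure Z} {κ θ δ ρ ε : ℝ} {n k : ℕ} {x : Fin n → Z}

/-- The samples on which some half-space, rejecting no sample point even at its full margin `ρ`,
rejects too much of `μ` once the margin is relaxed by the factor `1 - θ`. -/
def marginFailure (n : ℕ) (Φ : Z → H) (μ : Measure Z) (κ θ δ : ℝ) : Set (Fin n → Z) :=
  {x | ∃ (w : H) (ρ : ℝ), 0 < ρ ∧ (∀ i, ρ ≤ inner ℝ w (Φ (x i))) ∧
    56 * (κ * ‖w‖ / (θ * ρ)) ^ 2 * (Real.log n / n) + Real.log (n ^ 2 / (2 * δ)) / n <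
      μ.real (rejectedSet Φ ((1 - θ) * ρ) w)}

theorem mem_separableSamples_of_margin (hκ : 0 < κ) (hθ : 0 < θ) (hρ : 0 < ρ)
    (hΦκ : ∀ᵐ z ∂μ, ‖Φ z‖ ≤ κ) (hxκ : ∀ i, ‖Φ (x i)‖ ≤ κ) (hx : ∀ i, ρ ≤ inner ℝ w (Φ (x i)))
    (hk : (2 * (κ * ‖w‖ / (θ * ρ))) ^ 2 ≤ k) (hε : ε ≤ μ.real (rejectedSet Φ ((1 - θ) * ρ) w)) :
    x ∈ separableSamples (Fin n) Φ μ κ ((2 / θ - 1) * κ ^ 2) ε k := by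
  -- Rescale `w` so that the margin gap `θ * ρ` becomes `2 * κ ^ 2`.
  set a := 2 * κ ^ 2 / (θ * ρ) with ha
  have ha0 : 0 < a := by positivity
  refine ⟨a • w, ?_, fun i => ⟨hxκ i, ?_⟩, ?_⟩
  · calc ‖a • w‖ ^ 2 = (2 * (κ * ‖w‖ / (θ * ρ))) ^ 2 * κ ^ 2 := by
          rw [norm_smul, Real.norm_of_nonneg ha0.le, ha]
          ring
      _ ≤ k * κ ^ 2 := by gcongr
  · calc (2 / θ - 1) * κ ^ 2 + κ ^ 2 = a * ρ := by
          rw [ha]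
          field_simp
          ring
      _ ≤ inner ℝ (a • w) (Φ (x i)) := by
          rw [real_inner_smul_left]
          gcongr
          exact hx i
  · have hthreshold : (2 / θ - 1) * κ ^ 2 - κ ^ 2 = a * ((1 - θ) * ρ) := by
      rw [ha]
      field_simp
      ring
    have hbounded : ({y | ‖Φ y‖ ≤ κ} ∩ rejectedSet Φ ((1 - θ) * ρ) w : Set Z) =ᵐ[μ]
        rejectedSet Φ ((1 - θ) * ρ) w :=
      inter_ae_eq_right_of_ae_eq_univ (Filter.eventuallyEq_univ.2 hΦκ)
    rw [hthreshold, rejectedSet_smul Φ _ ha0, measureReal_congr hbounded]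
    exact hε

theorem mul_lt_two_mul_norm_of_rejectedSet_pos [NeZero n] (hΦκ : ∀ᵐ z ∂μ, ‖Φ z‖ ≤ κ)
    (hxκ : ∀ i, ‖Φ (x i)‖ ≤ κ) (hx : ∀ i, ρ ≤ inner ℝ w (Φ (x i)))
    (hpos : 0 < μ.real (rejectedSet Φ ((1 - θ) * ρ) w)) : θ * ρ < 2 * (κ * ‖w‖) := by
  have hinner : ∀ z, ‖Φ z‖ ≤ κ → |inner ℝ w (Φ z)| ≤ κ * ‖w‖ := fun z hz =>
    (abs_real_inner_le_norm w (Φ z)).trans (by rw [mul_comm κ]; gcongr)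
  obtain ⟨z, hz, hzκ⟩ : ∃ z ∈ rejectedSet Φ ((1 - θ) * ρ) w, ‖Φ z‖ ≤ κ :=
    Measure.exists_mem_of_measure_ne_zero_of_ae (fun h => hpos.ne' (by simp [measureReal_def, h]))
      (ae_restrict_of_ae hΦκ)
  have hz' : inner ℝ w (Φ z) < (1 - θ) * ρ := hz
  linarith [hx 0, (abs_le.1 (hinner z hzκ)).1, (abs_le.1 (hinner (x 0) (hxκ 0))).2]

theorem lt_of_errorBound_lt_one (hn : 2 ≤ n) (hδ : 0 < δ) (hδ1 : δ ≤ 1)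
    (h : errorBound n δ k < 1) : k < n := by
  by_contra! hnk
  have hn' : (0 : ℝ) < n := by positivity
  have hdiff : errorBound n δ k - errorBound n δ 0 = 7 * k * (Real.log n / n) := by
    simp [errorBound]
  have hlog : 7 * Real.log n ≤ 7 * k * (Real.log n / n) := by
    have : 1 ≤ (k : ℝ) / n := (one_le_div hn').2 (mod_cast hnk)
    calc 7 * Real.log n ≤ 7 * Real.log n * (k / n) :=
          le_mul_of_one_le_right (by positivity) this
      _ = _ := by ring
  linarith [errorBound_nonneg hn hδ hδ1 le_rfl, log_two_le_log_natCast hn, Real.log_two_gt_d9]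

theorem exists_mem_separableSamples_of_mem_marginFailure [IsProbabilityMeasure μ] (hn : 2 ≤ n)
    (hκ : 0 < κ) (hθ : 0 < θ) (hδ : 0 < δ) (hδ1 : δ ≤ 1) (hΦκ : ∀ᵐ z ∂μ, ‖Φ z‖ ≤ κ)
    (hxκ : ∀ i, ‖Φ (x i)‖ ≤ κ) (hx : x ∈ marginFailure n Φ μ κ θ δ) :
    ∃ k ∈ Finset.Ico 1 n,
      x ∈ separableSamples (Fin n) Φ μ κ ((2 / θ - 1) * κ ^ 2) (errorBound n δ k) k := by
  obtain ⟨w, ρ, hρ, hwx, hfail⟩ := hx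
  have : NeZero n := ⟨by omega⟩
  set r := κ * ‖w‖ / (θ * ρ)
  set y := (2 * r) ^ 2 with hy
  have hlevel : errorBound n δ (2 * y) < μ.real (rejectedSet Φ ((1 - θ) * ρ) w) := by
    convert hfail using 1
    rw [errorBound, hy]
    ring
  have hy1 : 1 ≤ y := by
    have hpos := (errorBound_nonneg hn hδ hδ1 (by positivity)).trans_lt hlevel
    have := mul_lt_two_mul_norm_of_rejectedSet_pos hΦκ hxκ hwx hpos
    refine one_le_pow₀ ?_
    rw [← mul_div_assoc, one_le_div (by positivity)]
    exact this.le
  have hceil : errorBound n δ ⌈y⌉₊ < μ.real (rejectedSet Φ ((1 - θ) * ρ) w) := by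
    refine lt_of_le_of_lt ?_ hlevel
    unfold errorBound
    gcongr
    exact Nat.ceil_le_two_mul (by linarith)
  refine ⟨⌈y⌉₊, Finset.mem_Ico.2 ⟨Nat.one_le_ceil_iff.2 (by linarith), ?_⟩, ?_⟩
  · exact lt_of_errorBound_lt_one hn hδ hδ1 (hceil.trans_le measureReal_le_one)
  · exact mem_separableSamples_of_margin hκ hθ hρ hΦκ hxκ hwx (Nat.le_ceil y) hceil.le

theorem measureReal_marginFailure_le [IsProbabilityMeasure μ] (hΦ : StronglyMeasurable Φ)
    (hΦκ : ∀ᵐ z ∂μ, ‖Φ z‖ ≤ κ) (hκ : 0 < κ) (hθ : 0 < θ) (hn : 2 ≤ n) (hδ : 0 < δ) :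
    (Measure.pi fun _ => μ).real (marginFailure n Φ μ κ θ δ) ≤ δ := by
  rcases le_total 1 δ with hδ1 | hδ1
  · exact measureReal_le_one.trans hδ1
  set ν : Measure (Fin n → Z) := Measure.pi fun _ => μ
  set S := fun k : ℕ =>
    separableSamples (Fin n) Φ μ κ ((2 / θ - 1) * κ ^ 2) (errorBound n δ k) k
  have hbounded : ∀ᵐ x ∂ν, ∀ i, ‖Φ (x i)‖ ≤ κ := ae_all_iff.2 fun i =>
    (measurePreserving_eval (fun _ => μ) i).quasiMeasurePreserving.ae hΦκ
  have hcover : marginFailure n Φ μ κ θ δ ≤ᵐ[ν] ⋃ k ∈ Finset.Ico 1 n, S k := by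
    filter_upwards [hbounded] with x hxκ hx
    obtain ⟨k, hk, hxk⟩ :=
      exists_mem_separableSamples_of_mem_marginFailure hn hκ hθ hδ hδ1 hΦκ hxκ hx
    exact Set.mem_iUnion₂_of_mem hk hxk
  calc ν.real (marginFailure n Φ μ κ θ δ) ≤ ν.real (⋃ k ∈ Finset.Ico 1 n, S k) :=
        ENNReal.toReal_mono (measure_ne_top _ _) (measure_mono_ae hcover)
    _ ≤ ∑ k ∈ Finset.Ico 1 n, ν.real (S k) := measureReal_biUnion_finset_le _ _
    _ ≤ ∑ _k ∈ Finset.Ico 1 n, δ / n := Finset.sum_le_sum fun k hk =>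
        measureReal_separableSamples_errorBound_le hΦ hκ hn hk hδ hδ1
    _ = (n - 1 : ℕ) * (δ / n) := by simp
    _ ≤ n * (δ / n) := by gcongr; exact n.sub_le 1
    _ = δ := mul_div_cancel₀ δ (by positivity)

end Margin

section Confidence

variable {Ω Y : Type*} [MeasurableSpace Ω] [MeasurableSpace Y] {P : Measure Ω}

theorem WithProbAtLeast.mono {q : ℝ} {A B : Set Ω} (hA : WithProbAtLeast P q A) (hAB : A ⊆ B) :
    WithProbAtLeast P q B := by
  obtain ⟨S, hSA, hS⟩ := hA
  exact ⟨S, hSA.trans hAB, hS⟩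

variable [IsProbabilityMeasure P] {ν : Measure Y} {δ : ℝ}

theorem withProbAtLeast_of_measureReal_compl_le {A : Set Ω} (hA : P.real Aᶜ ≤ δ) :
    WithProbAtLeast P (1 - δ) A := by
  refine ⟨(toMeasurable P Aᶜ)ᶜ, Set.compl_subset_comm.1 (subset_toMeasurable P _),
    (measurableSet_toMeasurable P _).compl, ?_⟩
  rw [← ofReal_measureReal, probReal_compl_eq_one_sub (measurableSet_toMeasurable P _),
    measureReal_def, measure_toMeasurable, ← measureReal_def]
  gcongr

theorem withProbAtLeast_of_hasLaw [IsProbabilityMeasure ν] {X : Ω → Y} (hX : HasLaw X ν P)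
    {S : Set Y} (hS : ν.real S ≤ δ) : WithProbAtLeast P (1 - δ) {ω | X ω ∉ S} := by
  refine withProbAtLeast_of_measureReal_compl_le (le_trans ?_ hS)
  have hpre : {ω | X ω ∉ S}ᶜ = X ⁻¹' S := compl_compl _
  rw [hpre]
  exact ENNReal.toReal_mono (measure_ne_top ν S)
    ((Measure.le_map_apply hX.aemeasurable S).trans_eq (by rw [hX.map_eq]))

end Confidence

section Classifier

variable {D n : ℕ} {H : Type*} [NormedAddCommGroup H] [InnerProductSpace ℝ H] {Φ : Pt D → H}
  {x : Fin n → Pt D} {w : H} {μ : Measure (Pt D)} {κ θ δ ρ : ℝ}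

theorem setOf_kernelClassifier_neg (Φ : Pt D → H) (w : H) (b : ℝ) :
    {z | kernelClassifier Φ w b z < 0} = rejectedSet Φ (-b) w := by
  ext z
  simp only [kernelClassifier, rejectedSet, Set.mem_ofPred_eq]
  split_ifs with h <;> simp <;> linarith

theorem IsOneClassSVM.measureReal_classifier_neg_le [NeZero n] (h : IsOneClassSVM Φ x w ρ)
    (hθ : 0 < θ) (hx : x ∉ marginFailure n Φ μ κ θ δ)
    (hm : 0 < confidenceMargin Φ w (-((1 - θ) * ρ)) x) :
    μ.real {z | kernelClassifier Φ w (-((1 - θ) * ρ)) z < 0} ≤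
      56 * κ ^ 2 / θ / confidenceMargin Φ w (-((1 - θ) * ρ)) x * (Real.log n / n) +
        Real.log (n ^ 2 / (2 * δ)) / n := by
  have hmargin : confidenceMargin Φ w (-((1 - θ) * ρ)) x = θ * ρ := by
    rw [h.confidenceMargin_eq]
    ring
  have hρ : 0 < ρ := by
    rw [hmargin] at hm
    exact pos_of_mul_pos_right hm hθ.le
  have hratio : 56 * κ ^ 2 / θ / (θ * ρ) = 56 * (κ * ‖w‖ / (θ * ρ)) ^ 2 := by
    rw [div_pow, mul_pow, h.norm_sq_eq]
    field_simp
  have hgood := not_lt.1 fun hfail => hx ⟨w, ρ, hρ, h.1, hfail⟩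
  simpa only [setOf_kernelClassifier_neg, neg_neg, hmargin, hratio] using hgood

end Classifier

theorem measurable_flow {D τ : ℕ} {F : ℕ → Pt D → Pt D} (hF : ∀ t < τ, Measurable (F t)) :
    Measurable (flow F τ) := by
  induction τ with
  | zero => exact measurable_id
  | succ t ih => exact (hF t t.lt_succ_self).comp (ih fun s hs => hF s (hs.trans t.lt_succ_self))

theorem IsOptimalTransportMap.hasLaw_comp_flow {D τ : ℕ} {F : ℕ → Pt D → Pt D}
    {T : Pt D → Pt D} {ρ₀ ν : Measure (Pt D)} (hT : IsOptimalTransportMap T (generatedLaw F τ ρ₀) ν)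
    (hF : Measurable (flow F τ)) {Ω : Type*} [MeasurableSpace Ω] {P : Measure Ω} {X : Ω → Pt D}
    (hX : HasLaw X ρ₀ P) : HasLaw (fun ω => T (flow F τ (X ω))) ν P := by
  have hgenerated : HasLaw (flow F τ) (generatedLaw F τ ρ₀) ρ₀ := ⟨hF.aemeasurable, rfl⟩
  have hmatched : HasLaw T ν (generatedLaw F τ ρ₀) := ⟨hT.measurable.aemeasurable, hT.map_eq⟩
  exact (hmatched.comp hgenerated).comp hX

theorem proposition4p1_general (κ : ℝ) {θ : ℝ} (hθ : 0 < θ) :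
    ∃ C : ℝ, 0 < C ∧
      ∀ (D n : ℕ) (_hn : 2 ≤ n) (δ : ℝ) (_hδ : 0 < δ)
        (pdata : Measure (Pt D)) (_hp : IsProbabilityMeasure pdata)
        (Ω : Type*) (_mΩ : MeasurableSpace Ω) (P : Measure Ω) (_hP : IsProbabilityMeasure P)
        (x : Fin n → Ω → Pt D) (_hlaw : ∀ i, HasLaw (x i) pdata P) (_hind : iIndepFun x P)
        (H : Type*) (_nH : NormedAddCommGroup H) (_iH : InnerProductSpace ℝ H)
        (Φ : Pt D → H) (_hΦ : StronglyMeasurable Φ) (_hκ : ∀ᵐ z ∂pdata, ‖Φ z‖ ≤ κ),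
        ∃ (w : Ω → H) (ρ b : Ω → ℝ) (f : Ω → Pt D → ℤ),
          (∀ ω, IsOneClassSVM Φ (fun i => x i ω) (w ω) (ρ ω)) ∧
          (∀ ω, b ω = -((1 - θ) * ρ ω)) ∧
          (∀ ω, f ω = kernelClassifier Φ (w ω) (b ω)) ∧
          WithProbAtLeast P (1 - δ)
            {ω | 0 < confidenceMargin Φ (w ω) (b ω) (fun i => x i ω) →
              ∃ c : ℝ, 0 ≤ c ∧ c ≤ C / confidenceMargin Φ (w ω) (b ω) (fun i => x i ω) ∧
                pdata.real {z | f ω z < 0} ≤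
                  c * (Real.log n / n) + Real.log ((n : ℝ) ^ 2 / (2 * δ)) / n} := by
  have hκ' : 0 < max κ 1 := lt_max_of_lt_right one_pos
  refine ⟨56 * max κ 1 ^ 2 / θ, by positivity, ?_⟩
  intro D n hn δ hδ pdata _ Ω _ P _ x hlaw hind H _ _ Φ hΦ hκ
  have : NeZero n := ⟨by omega⟩
  choose w ρ hsvm using fun ω => exists_isOneClassSVM Φ fun i => x i ω
  refine ⟨w, ρ, _, _, hsvm, fun _ => rfl, fun _ => rfl, ?_⟩
  have hfailure := measureReal_marginFailure_le hΦ (hκ.mono fun _ h => h.trans (le_max_left κ 1))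
    hκ' hθ hn hδ
  refine (withProbAtLeast_of_hasLaw (hind.hasLaw_pi hlaw) hfailure).mono fun ω hω hm => ?_
  exact ⟨_, by positivity, le_rfl, (hsvm ω).measureReal_classifier_neg_le hθ hω hm⟩

theorem proposition4p1 (κ θ : ℝ) (hθ : 0 < θ) (hθ1 : θ ≤ 1) :
    ∃ C : ℝ, 0 < C ∧
      ∀ (D d τ n : ℕ) (_hn : 2 ≤ n) (δ ε₀ : ℝ) (_hδ : 0 < δ) (_hε₀ : 0 < ε₀)
        -- the data distribution
        (pdata : Measure (Pt D)) (_hp : IsProbabilityMeasure pdata)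
        (_hM : IsCompact pdata.support)
        -- the source density and the generative model
        (ρ₀ : Measure (Pt D)) (_hρ₀ : IsProbabilityMeasure ρ₀) (_hac : ρ₀ ≪ volume)
        (F : ℕ → Pt D → Pt D) (_hF : ∀ t < τ, ContDiff ℝ 1 (F t))
        -- the optimal transport map from generated samples to data
        (T : Pt D → Pt D) (_hT : IsOptimalTransportMap T (generatedLaw F τ ρ₀) pdata)
        -- `n` independent sample paths, given by their starting points
        (Ω : Type*) (_mΩ : MeasurableSpace Ω) (P : Measure Ω) (_hP : IsProbabilityMeasure P)
        (X₀ : Fin n → Ω → Pt D) (_hlaw : ∀ i, HasLaw (X₀ i) ρ₀ P) (_hind : iIndepFun X₀ P)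
        -- convergence
        (_hconv : WithProbAtLeast P (1 - δ / 2)
          {ω | ∀ i, ‖T (flow F τ (X₀ i ω)) - flow F τ (X₀ i ω)‖ ≤ ε₀})
        -- alignment
        (E : Ω → ℕ → Pt D → Fin d → Pt D) (_hE : ∀ ω, IsMostSensitiveBundle F τ d (E ω))
        (_halign : WithProbAtLeast P (1 - δ / 2)
          {ω | ∀ i, T (flow F τ (X₀ i ω)) ∈ frontier pdata.support →
            Submodule.span ℝ (Set.range (E ω τ (X₀ i ω))) =
              tangentSpaceOf (frontier pdata.support) (T (flow F τ (X₀ i ω)))})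
        -- the feature map of a kernel that is bounded on the support
        (H : Type*) (_nH : NormedAddCommGroup H) (_iH : InnerProductSpace ℝ H)
        (Φ : Pt D → H) (_hΦ : StronglyMeasurable Φ) (_hκ : ∀ z ∈ pdata.support, ‖Φ z‖ ≤ κ),
        ∃ (w : Ω → H) (ρ b : Ω → ℝ) (f : Ω → Pt D → ℤ),
          (∀ ω, IsOneClassSVM Φ (fun i => T (flow F τ (X₀ i ω))) (w ω) (ρ ω)) ∧
          (∀ ω, b ω = -((1 - θ) * ρ ω)) ∧
          (∀ ω, f ω = kernelClassifier Φ (w ω) (b ω)) ∧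
          WithProbAtLeast P (1 - δ)
            {ω | 0 < confidenceMargin Φ (w ω) (b ω) (fun i => T (flow F τ (X₀ i ω))) →
              ∃ c : ℝ, 0 ≤ c ∧
                c ≤ C / confidenceMargin Φ (w ω) (b ω) (fun i => T (flow F τ (X₀ i ω))) ∧
                pdata.real {z | f ω z < 0} ≤
                  c * (Real.log n / n) + Real.log ((n : ℝ) ^ 2 / (2 * δ)) / n} := by
  obtain ⟨C, hC, h⟩ := proposition4p1_general κ hθ
  refine ⟨C, hC, ?_⟩
  intro D d τ n hn δ ε₀ hδ _ pdata hp _ ρ₀ _ _ F hF T hT Ω mΩ P hP X₀ hlaw hind _ E _ _ H nH iH Φ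
    hΦ hκ
  have hflow : Measurable (flow F τ) := measurable_flow fun t ht => (hF t ht).continuous.measurable
  exact h D n hn δ hδ pdata hp Ω mΩ P hP _ (fun i => hT.hasLaw_comp_flow hflow (hlaw i))
    (hind.comp _ fun _ => hT.measurable.comp hflow) H nH iH Φ hΦ
    (Filter.mem_of_superset Measure.support_mem_ae hκ)
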